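/- **Setting.** A stochastic game $\mathcal G=(V,(V_1,V_2,V_{\mathsf P}),\delta)$ with rewards consists of a finite vertex set $V$ partitioned into $V_1,V_2,V_{\mathsf P}$ (possibly empty blocks), a function $\delta:V\times V\to[0,1]$ with $\delta(v,v')\in\{0,1\}$ for $v\in V_1\cup V_2$ and $\sum_{v'}\delta(v,v')=1$ for $v\in V_{\mathsf P}$, such that $\mathrm{post}(v)=\{v'\mid\delta(v,v')>0\}\neq\emptyset$ for all $v$, and a reward function $r:V\to[0,\infty)$ with $r(v)=0$ for every terminal vertex $v$; here $v$ is terminal if $\delta(v,v)=1$ and $\delta(v,v')=0$ for all $v'\ne v$, and $T$ denotes the set of terminal vertices. A strategy of Player $i\in\{1,2\}$ is a map $\pi_i$ assigning to each finite sequence $\hat\omega v\in V^*V_i$ a probability distribution on $V$ supported in $\mathrm{post}(v)$. It is memoryless if $\pi_i(\hat\omega v)=\pi_i(v)$ for all $\hat\omega\in V^*$, and semi-Markov if $\pi_i(u\hat\omega v)=\pi_i(u\hat\omega' v)$ for all $u\in V$, $v\in V_i$ and $\hat\omega,\hat\omega'\in V^*$ with $|\hat\omega|=|\hat\omega'|$.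 Strategies $\pi_1,\pi_2$ and an initial vertex $v$ determine a probability measure $\mathbb P^{\pi_1,\pi_2}_{v}$ on infinite plays (with the $\sigma$-algebra generated by cylinders), with expectation $\mathbb E^{\pi_1,\pi_2}_{v}$. A path is a sequence $\omega\in V^{\mathbb N}$ with $\omega_{k+1}\in\mathrm{post}(\omega_k)$ for all $k$; it is fair (for Player 2) if every $v'\in V_2$ occurring infinitely often in $\omega$ has all of $\mathrm{post}(v')$ occurring infinitely often in $\omega$. A strategy $\pi_2$ is fair if $\mathbb P^{\pi_1,\pi_2}_{v}(\omega\text{ is fair})=1$ for every Player 1 strategy $\pi_1$ and every $v\in V$. The game is stopping under fairness if $\mathbb P^{\pi_1,\pi_2}_{v}(\exists i:\ \omega_i\in T)=1$ for every Player 1 strategy $\pi_1$, every fair $\pi_2$ and every $v\in V$. Finally $\mathrm{rew}(\omega)=\sum_{i=0}^\infty r(\omega_i)\in[0,\infty]$. **Theorem.** Let $\mathcal G$ be a stochastic game with rewards that is stopping under fairness, and let $v\in V$. Let $\Pi_1^{S}$ and $\Pi_1^{M}$ be the sets of semi-Markov and of memoryless strategies of Player 1, and let $\Pi_2^{MF}$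 be the set of memoryless fair strategies of Player 2. Then $$\sup_{\pi_1\in\Pi_1^{S}}\ \inf_{\pi_2\in\Pi_2^{MF}}\mathbb E^{\pi_1,\pi_2}_{v}[\mathrm{rew}]\;=\;\sup_{\pi_1\in\Pi_1^{M}}\ \inf_{\pi_2\in\Pi_2^{MF}}\mathbb E^{\pi_1,\pi_2}_{v}[\mathrm{rew}].$$ -/

import Mathlib

open MeasureTheory ProbabilityTheory Filter
open scoped ENNReal NNReal

noncomputable section

/-- Who moves at a vertex: Player 1, Player 2, or chance (probabilistic vertices). -/
inductive Owner
  | one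
  | two
  | chance

/-- A stochastic game `(V, (V₁, V₂, V_P), δ)` on a finite vertex set `V`. The partition of `V`
into `V₁`, `V₂`, `V_P` (blocks may be empty) is given by `owner`. -/
structure StochasticGame (V : Type*) [Fintype V] where
  owner : V → Owner
  /-- the transition function -/
  δ : V → V → ℝ≥0
  /-- on player vertices `δ` is `{0, 1}`-valued (an edge relation) -/
  δ_player : ∀ v, owner v ≠ Owner.chance → ∀ w, δ v w = 0 ∨ δ v w = 1
  /-- on chance vertices `δ v` is a probability distribution -/
  δ_chance : ∀ v, owner v = Owner.chance → ∑ w, δ v w = 1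
  /-- every vertex has a successor -/
  exists_succ : ∀ v, ∃ w, 0 < δ v w

namespace StochasticGame

variable {V : Type*} [Fintype V] (G : StochasticGame V)

/-- The set of successors of a vertex. -/
def post (v : V) : Set V := {w | 0 < G.δ v w}

/-- The set `T` of terminal vertices. -/
def terminal : Set V := {v | G.δ v v = 1 ∧ ∀ w, w ≠ v → G.δ v w = 0}

/-- The set of (infinite) paths of the game. -/
def paths : Set (ℕ → V) := {ω | ∀ k, ω (k + 1) ∈ G.post (ω k)}

/-- The vertices controlled by `p`. -/
abbrev Vertex (p : Owner) : Type _ := {v : V // G.owner v = p}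

/-- A (randomized, history-dependent) strategy of player `p`, i.e. a map `V* V_p → 𝒟(V)`.
`σ h v` is the distribution chosen after the finite sequence `h` (in chronological order)
followed by the current vertex `v`; it may only charge successors of `v`. -/
structure Strategy (p : Owner) where
  toFun : List V → G.Vertex p → PMF V
  support_subset : ∀ h v, (toFun h v).support ⊆ G.post v

variable {G} in
/-- A memoryless strategy only looks at the current vertex. -/
def Strategy.Memoryless {p : Owner} (σ : G.Strategy p) : Prop :=
  ∀ (h : List V) (v : G.Vertex p), σ.toFun h v = σ.toFun [] v

variable {G} in
/-- A semi-Markov strategy only looks at the initial vertex, the length of the play and the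
current vertex. -/
def Strategy.SemiMarkov {p : Owner} (σ : G.Strategy p) : Prop :=
  ∀ (u : V) (h h' : List V), h.length = h'.length →
    ∀ v : G.Vertex p, σ.toFun (u :: h) v = σ.toFun (u :: h') v

/-- The distribution `δ(v, ·)` at a chance vertex. -/
def chancePMF (v : V) (hv : G.owner v = Owner.chance) : PMF V :=
  PMF.ofFintype (fun w => (G.δ v w : ℝ≥0∞)) (by exact_mod_cast G.δ_chance v hv)

/-- The distribution of the next vertex when the vertices visited before are `h`, the current
vertex is `v`, and the players use `σ₁` and `σ₂`. -/
def step (σ₁ : G.Strategy Owner.one) (σ₂ : G.Strategy Owner.two) (h : List V) (v : V) : PMF V :=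
  match hv : G.owner v with
  | Owner.one => σ₁.toFun h ⟨v, hv⟩
  | Owner.two => σ₂.toFun h ⟨v, hv⟩
  | Owner.chance => G.chancePMF v hv

/-- The vertices `x 0, …, x (n - 1)` visited strictly before time `n`, as a list. -/
def past {n : ℕ} (x : Finset.Iic n → V) : List V :=
  List.ofFn fun i : Fin n => x ⟨i, Finset.mem_Iic.2 i.2.le⟩

/-- The current (time `n`) vertex of a play prefix `x 0, …, x n`. -/
def current {n : ℕ} (x : Finset.Iic n → V) : V := x ⟨n, Finset.mem_Iic.2 le_rfl⟩

section Measure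

variable [MeasurableSpace V] [MeasurableSingletonClass V]

/-- The transition kernel from play prefixes `x 0, …, x n` to the vertex at time `n + 1`. -/
def stepKernel (σ₁ : G.Strategy Owner.one) (σ₂ : G.Strategy Owner.two) (n : ℕ) :
    Kernel (Finset.Iic n → V) V :=
  Kernel.ofFunOfCountable fun x => (G.step σ₁ σ₂ (past x) (current x)).toMeasure

instance (σ₁ : G.Strategy Owner.one) (σ₂ : G.Strategy Owner.two) (n : ℕ) :
    IsMarkovKernel (G.stepKernel σ₁ σ₂ n) :=
  ⟨fun x => PMF.toMeasure.isProbabilityMeasure (G.step σ₁ σ₂ (past x) (current x))⟩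

/-- The law of the play starting at `v` when the players use `σ₁` and `σ₂` (Ionescu-Tulcea),
as a probability measure on `ℕ → V` with its product (that is, cylinder) σ-algebra. -/
def prob (σ₁ : G.Strategy Owner.one) (σ₂ : G.Strategy Owner.two) (v : V) : Measure (ℕ → V) :=
  Kernel.traj (X := fun _ => V) (G.stepKernel σ₁ σ₂) 0 (fun _ => v)

/-- The set `inf(ω)` of vertices that occur infinitely often in `ω`. -/
def infOften (ω : ℕ → V) : Set V := {v | ∃ᶠ n in atTop, ω n = v}

/-- The set of fair plays for Player 2. -/
def fairPlays : Set (ℕ → V) :=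
  {ω | ω ∈ G.paths ∧
    ∀ v, G.owner v = Owner.two → v ∈ infOften ω → G.post v ⊆ infOften ω}

/-- The set `◇T` of plays that reach a terminal vertex. -/
def reachTerminal : Set (ℕ → V) := {ω | ω ∈ G.paths ∧ ∃ i, ω i ∈ G.terminal}

variable {G} in
/-- (Almost-surely) fair strategies of Player 2. -/
def Strategy.Fair (σ₂ : G.Strategy Owner.two) : Prop :=
  ∀ (σ₁ : G.Strategy Owner.one) (v : V), G.prob σ₁ σ₂ v G.fairPlays = 1

/-- The game is stopping under fairness. -/
def StoppingUnderFairness : Prop :=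
  ∀ (σ₁ : G.Strategy Owner.one) (σ₂ : G.Strategy Owner.two), σ₂.Fair →
    ∀ v : V, G.prob σ₁ σ₂ v G.reachTerminal = 1

end Measure

end StochasticGame

/-- A stochastic game with non-negative rewards on the vertices, which vanish at terminal
vertices. -/
structure RewardGame (V : Type*) [Fintype V] extends StochasticGame V where
  r : V → ℝ≥0
  r_terminal : ∀ v ∈ toStochasticGame.terminal, r v = 0

namespace RewardGame

variable {V : Type*} [Fintype V] (G : RewardGame V)

/-- The total accumulated reward of a play. -/
def rew (ω : ℕ → V) : ℝ≥0∞ := ∑' i, (G.r (ω i) : ℝ≥0∞)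

/-- The expected total accumulated reward from `v` under `σ₁` and `σ₂`. -/
def expectedReward [MeasurableSpace V] [MeasurableSingletonClass V]
    (σ₁ : G.Strategy Owner.one) (σ₂ : G.Strategy Owner.two) (v : V) : ℝ≥0∞ :=
  ∫⁻ ω, G.rew ω ∂(G.prob σ₁ σ₂ v)

end RewardGame

end

noncomputable section

namespace StochasticGame

variable {V : Type*} [Fintype V] (G : StochasticGame V)

/-! ### The law of a play, and bounds on the total reward by super- and subharmonic functions. -/

section Trajectories

/-! Both suprema are squeezed against one number, `fairValue`.

Force Player 2 to move uniformly with probability `ε` and let it minimise otherwise. The value of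
this game, `perturbedValue`, is the least fixed point of a Bellman operator. For `ε > 0` the
corresponding memoryless strategy of Player 2 is fair and, since the value is superharmonic, holds
every strategy of Player 1 to at most that value (`exists_memoryless_fair_le`). Hence no Player 1
strategy guarantees more than the infimum `fairValue` over `ε = 1 / (k + 1)`.

Conversely, in the limit the forced randomness disappears: `fairValue` is subharmonic for every move
of Player 2, provided Player 1 moves to a successor maximising it. Against a fair opponent the play
reaches a terminal vertex almost surely, so the remainder of the telescoped inequality vanishes and
this memoryless choice earns at least `fairValue` (`exists_memoryless_fairValue_le`).

The last step needs `fairValue` to be finite and zero on terminal vertices. This follows from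
`exists_bellman_le`, which turns almost sure stopping against the uniform Player 2 into a finite
superharmonic bound by means of a potential with upward drift. -/

theorem sum_pmf (s : PMF V) : ∑ w, s w = 1 := by
  rw [← tsum_fintype (L := .unconditional V)]; exact PMF.tsum_coe _

/-- The vertices visited strictly before time `n`, as a list. -/
def hist (n : ℕ) (ω : ℕ → V) : List V := List.ofFn fun i : Fin n => ω i

variable (σ₁ : G.Strategy Owner.one) (σ₂ : G.Strategy Owner.two)

theorem step_support_subset (h : List V) (u : V) :
    (G.step σ₁ σ₂ h u).support ⊆ G.post u := by
  unfold step
  split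
  · exact σ₁.support_subset _ _
  · exact σ₂.support_subset _ _
  · intro w hw
    simpa [chancePMF, post, pos_iff_ne_zero] using hw

theorem step_eq_zero {h : List V} {u w : V} (hw : w ∉ G.post u) :
    G.step σ₁ σ₂ h u w = 0 := by
  by_contra hne
  exact hw (G.step_support_subset σ₁ σ₂ h u hne)

theorem sum_step (h : List V) (u : V) : ∑ w, G.step σ₁ σ₂ h u w = 1 := sum_pmf _

theorem eq_of_mem_paths_of_mem_terminal {ω : ℕ → V} (hω : ω ∈ G.paths) {i : ℕ}
    (hi : ω i ∈ G.terminal) {j : ℕ} (hij : i ≤ j) : ω j = ω i := by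
  induction j, hij using Nat.le_induction with
  | base => rfl
  | succ j _ ih =>
    by_contra hne
    have := hω j
    rw [ih] at this
    exact (ne_of_gt this) (hi.2 _ hne)

section Probability

variable [MeasurableSpace V] [MeasurableSingletonClass V] (v : V)

instance isProbabilityMeasure_prob : IsProbabilityMeasure (G.prob σ₁ σ₂ v) := by
  unfold prob; infer_instance

theorem lintegral_pmf_toMeasure (p : PMF V) (f : V → ℝ≥0∞) :
    ∫⁻ w, f w ∂p.toMeasure = ∑ w, p w * f w := by
  rw [lintegral_fintype]
  simp only [PMF.toMeasure_apply_singleton _ _ (MeasurableSet.singleton _), mul_comm]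

/-- By the Ionescu-Tulcea construction, the joint law of a prefix and the next vertex is the prefix
law composed with `stepKernel`. This is the Markov-type identity behind all later martingale
arguments. -/
theorem lintegral_prob_prefix (n : ℕ) (F : (Finset.Iic n → V) → V → ℝ≥0∞) :
    ∫⁻ ω, F (Preorder.frestrictLe n ω) (ω (n + 1)) ∂G.prob σ₁ σ₂ v =
      ∫⁻ ω, ∑ w, G.step σ₁ σ₂ (hist n ω) (ω n) w * F (Preorder.frestrictLe n ω) w
        ∂G.prob σ₁ σ₂ v := by
  have h := Kernel.partialTraj_compProd_eq_map_traj (X := fun _ => V)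
    (κ := G.stepKernel σ₁ σ₂) (Nat.zero_le n) (x₀ := fun _ => v)
  have hF : Measurable (Function.uncurry F) := .of_discrete
  have h1 : ∫⁻ ω, F (Preorder.frestrictLe n ω) (ω (n + 1)) ∂G.prob σ₁ σ₂ v =
      ∫⁻ z, Function.uncurry F z ∂((G.prob σ₁ σ₂ v).map
        (fun x => (Preorder.frestrictLe n x, x (n + 1)))) := by
    rw [lintegral_map hF (by fun_prop)]; rfl
  rw [h1, prob, ← h, Measure.lintegral_compProd hF,
    ← Kernel.traj_map_frestrictLe_apply, lintegral_map .of_discrete (by fun_prop)]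
  refine lintegral_congr fun ω => ?_
  exact lintegral_pmf_toMeasure _ _

theorem lintegral_prob_mul_step (n : ℕ) {A : (ℕ → V) → ℝ≥0∞}
    (hA : ∀ ω ω' : ℕ → V, (∀ i ≤ n, ω i = ω' i) → A ω = A ω') (g : V → V → ℝ≥0∞) :
    ∫⁻ ω, A ω * g (ω n) (ω (n + 1)) ∂G.prob σ₁ σ₂ v =
      ∫⁻ ω, A ω * ∑ w, G.step σ₁ σ₂ (hist n ω) (ω n) w * g (ω n) w ∂G.prob σ₁ σ₂ v := by
  -- The prefix is padded with `v` after time `n`; `A` does not see the padding.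
  have h := G.lintegral_prob_prefix σ₁ σ₂ v n fun x w =>
    A (fun i => if h : i ≤ n then x ⟨i, Finset.mem_Iic.2 h⟩ else v) * g (current x) w
  have key : ∀ ω : ℕ → V, A (fun i => if h : i ≤ n then
      (Preorder.frestrictLe n ω : Finset.Iic n → V) ⟨i, Finset.mem_Iic.2 h⟩ else v) = A ω :=
    fun ω => hA _ _ fun i hi => by simp [hi]
  simp only [key] at h
  rw [show (fun ω : ℕ → V => A ω * g (ω n) (ω (n + 1))) = fun ω =>
    A ω * g (current (Preorder.frestrictLe (π := fun _ => V) n ω)) (ω (n + 1)) from rfl, h]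
  refine lintegral_congr fun ω => ?_
  rw [Finset.mul_sum]
  refine Finset.sum_congr rfl fun w _ => ?_
  rw [mul_left_comm]; rfl

theorem lintegral_prob_step (n : ℕ) (g : V → V → ℝ≥0∞) :
    ∫⁻ ω, g (ω n) (ω (n + 1)) ∂G.prob σ₁ σ₂ v =
      ∫⁻ ω, ∑ w, G.step σ₁ σ₂ (hist n ω) (ω n) w * g (ω n) w ∂G.prob σ₁ σ₂ v := by
  simpa using G.lintegral_prob_mul_step σ₁ σ₂ v n (A := fun _ => 1) (fun _ _ _ => rfl) g

theorem lintegral_prob_zero (f : V → ℝ≥0∞) :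
    ∫⁻ ω, f (ω 0) ∂G.prob σ₁ σ₂ v = f v := by
  have h : ∫⁻ ω, f (ω 0) ∂G.prob σ₁ σ₂ v =
      ∫⁻ x, f (x ⟨0, by simp⟩) ∂((G.prob σ₁ σ₂ v).map (Preorder.frestrictLe 0)) := by
    rw [lintegral_map .of_discrete (by fun_prop)]; rfl
  rw [h, prob, Kernel.traj_map_frestrictLe_apply, Kernel.partialTraj_self, Kernel.id_apply,
    lintegral_dirac]

theorem ae_mem_paths : ∀ᵐ ω ∂G.prob σ₁ σ₂ v, ω ∈ G.paths := by
  classical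
  refine ae_all_iff.2 fun n => ?_
  have h := G.lintegral_prob_step σ₁ σ₂ v n fun a b => if b ∈ G.post a then 0 else 1
  have h0 : ∀ ω : ℕ → V, ∑ w, G.step σ₁ σ₂ (hist n ω) (ω n) w *
      (if w ∈ G.post (ω n) then (0 : ℝ≥0∞) else 1) = 0 := by
    refine fun ω => Finset.sum_eq_zero fun w _ => ?_
    by_cases hw : w ∈ G.post (ω n)
    · simp [hw]
    · simp [G.step_eq_zero σ₁ σ₂ hw]
  simp only [h0, lintegral_zero] at h
  rw [lintegral_eq_zero_iff] at h
  · filter_upwards [h] with ω hω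
    by_contra hn
    simp [hn] at hω
  · have : Measurable (fun p : V × V => if p.2 ∈ G.post p.1 then (0 : ℝ≥0∞) else 1) :=
      .of_discrete
    exact this.comp (f := fun ω : ℕ → V => (ω n, ω (n + 1))) (by fun_prop)

theorem measurableSet_reachTerminal : MeasurableSet G.reachTerminal := by
  have h1 : MeasurableSet G.paths := by
    rw [paths, Set.ofPred_forall]
    refine MeasurableSet.iInter fun n => ?_
    have : MeasurableSet {p : V × V | p.2 ∈ G.post p.1} := .of_discrete
    exact this.preimage (f := fun ω : ℕ → V => (ω n, ω (n + 1))) (by fun_prop)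
  have h2 : MeasurableSet {ω : ℕ → V | ∃ i, ω i ∈ G.terminal} := by
    rw [Set.ofPred_exists]
    refine MeasurableSet.iUnion fun n => ?_
    have : MeasurableSet G.terminal := .of_discrete
    exact this.preimage (measurable_pi_apply n)
  exact h1.inter h2

-- Terminal vertices are absorbing along paths, so reaching one means staying there.
variable {σ₂} in
theorem ae_eventually_mem_terminal (hG : G.StoppingUnderFairness) (hσ₂ : σ₂.Fair) :
    ∀ᵐ ω ∂G.prob σ₁ σ₂ v, ∀ᶠ n in atTop, ω n ∈ G.terminal := by
  have h := hG σ₁ σ₂ hσ₂ v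
  rw [← mem_ae_iff_prob_eq_one G.measurableSet_reachTerminal] at h
  filter_upwards [h] with ω hω
  obtain ⟨hp, i, hi⟩ := hω
  filter_upwards [eventually_ge_atTop i] with n hn
  rwa [G.eq_of_mem_paths_of_mem_terminal hp hi hn]

theorem measurable_eval_discrete (f : V → ℝ≥0∞) (n : ℕ) : Measurable fun ω : ℕ → V => f (ω n) :=
  (Measurable.of_discrete (f := f)).comp (measurable_pi_apply n)

/-- A superharmonic function for the total reward bounds the expected total reward. -/
theorem lintegral_tsum_le {r f : V → ℝ≥0∞}
    (hf : ∀ h u, r u + ∑ w, G.step σ₁ σ₂ h u w * f w ≤ f u) :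
    ∫⁻ ω, ∑' i, r (ω i) ∂G.prob σ₁ σ₂ v ≤ f v := by
  -- The reward collected before time `n` plus `f` at time `n` has nonincreasing expectation.
  have key : ∀ n, ∑ i ∈ Finset.range n, ∫⁻ ω, r (ω i) ∂G.prob σ₁ σ₂ v
      + ∫⁻ ω, f (ω n) ∂G.prob σ₁ σ₂ v ≤ f v := by
    intro n
    induction n with
    | zero => simp [lintegral_prob_zero]
    | succ n ih =>
      refine le_trans ?_ ih
      rw [Finset.sum_range_succ, add_assoc, G.lintegral_prob_step σ₁ σ₂ v n fun _ b => f b,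
        ← lintegral_add_left (measurable_eval_discrete _ _)]
      gcongr
      exact hf _ _
  rw [lintegral_tsum fun i => (measurable_eval_discrete _ _).aemeasurable]
  exact ENNReal.tsum_le_of_sum_range_le fun n => le_self_add.trans (key n)

variable {σ₂} in
/-- A finite subharmonic function for the total reward that vanishes at terminal vertices is a
lower bound for the expected total reward when Player 2 is fair. -/
theorem le_lintegral_tsum (hG : G.StoppingUnderFairness) (hσ₂ : σ₂.Fair) {r f : V → ℝ≥0∞}
    (hfin : ∀ u, f u ≠ ∞) (hT : ∀ u ∈ G.terminal, f u = 0)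
    (hf : ∀ h u, f u ≤ r u + ∑ w, G.step σ₁ σ₂ h u w * f w) :
    f v ≤ ∫⁻ ω, ∑' i, r (ω i) ∂G.prob σ₁ σ₂ v := by
  have key : ∀ n, f v ≤ ∫⁻ ω, ∑' i, r (ω i) ∂G.prob σ₁ σ₂ v
      + ∫⁻ ω, f (ω n) ∂G.prob σ₁ σ₂ v := by
    intro n
    have h : f v ≤ ∑ i ∈ Finset.range n, ∫⁻ ω, r (ω i) ∂G.prob σ₁ σ₂ v
        + ∫⁻ ω, f (ω n) ∂G.prob σ₁ σ₂ v := by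
      induction n with
      | zero => simp [lintegral_prob_zero]
      | succ n ih =>
        refine ih.trans ?_
        rw [Finset.sum_range_succ, add_assoc, G.lintegral_prob_step σ₁ σ₂ v n fun _ b => f b,
          ← lintegral_add_left (measurable_eval_discrete _ _)]
        gcongr
        exact hf _ _
    refine h.trans ?_
    gcongr
    rw [lintegral_tsum fun i => (measurable_eval_discrete _ _).aemeasurable]
    exact ENNReal.sum_le_tsum _
  -- Fairness and stopping enter here: `f (ω n)` is eventually zero almost surely, and the finite
  -- constant `∑ u, f u` dominates.
  have lim : Tendsto (fun n => ∫⁻ ω, f (ω n) ∂G.prob σ₁ σ₂ v) atTop (nhds 0) := by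
    have := tendsto_lintegral_of_dominated_convergence (μ := G.prob σ₁ σ₂ v)
      (F := fun n ω => f (ω n)) (f := fun _ => 0) (fun _ => ∑ u, f u)
      (fun n => measurable_eval_discrete _ _)
      (fun n => Eventually.of_forall fun ω => Finset.single_le_sum (fun _ _ => zero_le)
        (Finset.mem_univ (ω n)))
      (by simpa using hfin) (by
        filter_upwards [G.ae_eventually_mem_terminal σ₁ v hG hσ₂] with ω hω
        refine tendsto_const_nhds.congr' ?_
        filter_upwards [hω] with n hn
        exact (hT _ hn).symm)
    simpa using this
  refine ge_of_tendsto' (x := atTop) ?_ key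
  simpa using lim.const_add (∫⁻ ω, ∑' i, r (ω i) ∂G.prob σ₁ σ₂ v)

end Probability

end Trajectories

theorem step_of_owner_one (σ₁ : G.Strategy Owner.one) (σ₂ : G.Strategy Owner.two)
    (h : List V) {u : V} (hu : G.owner u = Owner.one) :
    G.step σ₁ σ₂ h u = σ₁.toFun h ⟨u, hu⟩ := by
  unfold step
  split <;> first | rfl | (rename_i h'; rw [hu] at h'; cases h')

theorem step_of_owner_two (σ₁ : G.Strategy Owner.one) (σ₂ : G.Strategy Owner.two)
    (h : List V) {u : V} (hu : G.owner u = Owner.two) :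
    G.step σ₁ σ₂ h u = σ₂.toFun h ⟨u, hu⟩ := by
  unfold step
  split <;> first | rfl | (rename_i h'; rw [hu] at h'; cases h')

theorem step_of_owner_chance (σ₁ : G.Strategy Owner.one) (σ₂ : G.Strategy Owner.two)
    (h : List V) {u : V} (hu : G.owner u = Owner.chance) :
    G.step σ₁ σ₂ h u = G.chancePMF u hu := by
  unfold step
  split <;> first | rfl | (rename_i h'; rw [hu] at h'; cases h')

/-! ### Moves of probability bounded below recur, hence give fairness. -/

/-- The supermartingale factor of a move from `a` to `b` used to show that `w` is visited
infinitely often if `u` is: visits of `u` are rewarded and visits of `w` kill the process. -/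
def fairFactor (p : ℝ≥0∞) (u w : V) (a b : V) : ℝ≥0∞ :=
  open Classical in (if a = u then 1 + p else 1) * (if b = w then 0 else 1)

/-- At `u` the sum is `(1 + p) * (1 - s w)`, and the gain `p * (1 - s w) ≤ p` is paid for by the
lost mass `s w ≥ p`. -/
theorem sum_mul_fairFactor_le {p : ℝ≥0∞} {u w : V} (s : PMF V) (a : V) (hp : a = u → p ≤ s w) :
    ∑ b, s b * fairFactor p u w a b ≤ 1 := by
  classical
  have hq : s w + ∑ b ∈ Finset.univ.erase w, s b = 1 := by
    rw [Finset.add_sum_erase _ _ (Finset.mem_univ w), sum_pmf]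
  have hsum : ∑ b, s b * (if b = w then (0 : ℝ≥0∞) else 1) =
      ∑ b ∈ Finset.univ.erase w, s b := by
    rw [← Finset.add_sum_erase _ _ (Finset.mem_univ w)]
    simp only [if_true, mul_zero, zero_add]
    exact Finset.sum_congr rfl fun b hb => by simp [Finset.ne_of_mem_erase hb]
  have hq1 : ∑ b ∈ Finset.univ.erase w, s b ≤ 1 := hq ▸ le_add_self
  simp only [fairFactor]
  by_cases h : a = u
  · simp only [h, if_true, mul_left_comm _ (1 + p)]
    rw [← Finset.mul_sum, hsum, add_mul, one_mul, ← hq, add_comm (s w)]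
    gcongr
    exact (mul_le_of_le_one_right' hq1).trans (hp h)
  · simpa only [h, if_false, one_mul, hsum] using hq1

section Probability

variable [MeasurableSpace V] [MeasurableSingletonClass V]

/-- A product of `fairFactor`s is a nonnegative supermartingale. If `w` were avoided from some time
on while `u` recurs, the product would gain a factor `1 + p` infinitely often and diverge, which has
probability zero. -/
theorem ae_frequently_of_frequently (σ₁ : G.Strategy Owner.one) (σ₂ : G.Strategy Owner.two)
    (v : V) {p : ℝ≥0∞} (hp : p ≠ 0) {u w : V} (hstep : ∀ h, p ≤ G.step σ₁ σ₂ h u w) :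
    ∀ᵐ ω ∂G.prob σ₁ σ₂ v, (∃ᶠ n in atTop, ω n = u) → ∃ᶠ n in atTop, ω n = w := by
  classical
  have main : ∀ N : ℕ, ∀ᵐ ω ∂G.prob σ₁ σ₂ v, (∃ᶠ n in atTop, ω n = u) →
      ¬ ∀ i ≥ N, ω (i + 1) ≠ w := by
    intro N
    -- Factors before `N` are trivial, so early visits to `w` do not kill the product.
    let φ : ℕ → V → V → ℝ≥0∞ := fun i a b => if i < N then 1 else fairFactor p u w a b
    let Z : ℕ → (ℕ → V) → ℝ≥0∞ := fun n ω => ∏ i ∈ Finset.range n, φ i (ω i) (ω (i + 1))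
    have hZmeas : ∀ n, Measurable (Z n) := fun n => by
      refine Finset.measurable_prod _ fun i _ => ?_
      have : Measurable (Function.uncurry (φ i)) := .of_discrete
      exact this.comp (f := fun ω : ℕ → V => (ω i, ω (i + 1))) (by fun_prop)
    have hZint : ∀ n, ∫⁻ ω, Z n ω ∂G.prob σ₁ σ₂ v ≤ 1 := by
      intro n
      induction n with
      | zero => simp [Z]
      | succ n ih =>
        refine le_trans ?_ ih
        have h := G.lintegral_prob_mul_step σ₁ σ₂ v n (A := Z n) (fun ω ω' hω =>
          Finset.prod_congr rfl fun i hi => by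
            rw [Finset.mem_range] at hi
            rw [hω i hi.le, hω (i + 1) hi]) (φ n)
        have hs : ∀ ω, Z (n + 1) ω = Z n ω * φ n (ω n) (ω (n + 1)) :=
          fun ω => Finset.prod_range_succ _ _
        simp only [hs, h]
        refine lintegral_mono fun ω => mul_le_of_le_one_right' ?_
        by_cases hn : n < N
        · simp [φ, hn, sum_step]
        · simp only [φ, hn, if_false]
          exact sum_mul_fairFactor_le _ _ fun h => h ▸ hstep _
    -- Fatou's lemma replaces supermartingale convergence.
    have hlim : ∀ᵐ ω ∂G.prob σ₁ σ₂ v, liminf (fun n => Z n ω) atTop < ∞ := by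
      refine ae_lt_top (.liminf hZmeas) (ne_top_of_le_ne_top ENNReal.one_ne_top ?_)
      refine (lintegral_liminf_le hZmeas).trans ?_
      exact liminf_le_of_frequently_le' (Frequently.of_forall hZint)
    filter_upwards [hlim] with ω hω hu hw
    have hφ : ∀ i ≥ N, φ i (ω i) (ω (i + 1)) = if ω i = u then 1 + p else 1 := fun i hi => by
      simp [φ, fairFactor, hi.not_gt, hw i hi]
    have hmono : ∀ n ≥ N, ∀ m ≥ n, Z n ω ≤ Z m ω := by
      intro n hn m hm
      induction m, hm using Nat.le_induction with
      | base => rfl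
      | succ m hm ih =>
        refine ih.trans ?_
        simp only [Z, Finset.prod_range_succ]
        refine le_mul_of_one_le_right' ?_
        rw [hφ m (hn.trans hm)]
        split <;> simp
    have hgrow : ∀ K : ℕ, ∃ n ≥ N, (1 + p) ^ K ≤ Z n ω := by
      intro K
      induction K with
      | zero =>
        refine ⟨N, le_rfl, ?_⟩
        rw [pow_zero]
        refine (Finset.prod_eq_one fun i hi => ?_).ge
        simp [φ, Finset.mem_range.1 hi]
      | succ K ih =>
        obtain ⟨n, hn, h⟩ := ih
        obtain ⟨m, hm, hmu⟩ := frequently_atTop.1 hu n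
        refine ⟨m + 1, (hn.trans hm).trans m.le_succ, ?_⟩
        simp only [Z, Finset.prod_range_succ, pow_succ]
        rw [hφ m (hn.trans hm), if_pos hmu]
        gcongr
        exact h.trans (hmono n hn m hm)
    have htop : Tendsto (fun n => Z n ω) atTop (nhds ∞) := by
      have hpow : Tendsto (fun K : ℕ => (1 + p) ^ K) atTop (nhds ∞) :=
        ENNReal.tendsto_pow_atTop_nhds_top_iff.2 (ENNReal.lt_add_right ENNReal.one_ne_top hp)
      refine ENNReal.tendsto_nhds_top fun k => ?_
      obtain ⟨K, hK⟩ := (hpow.eventually (lt_mem_nhds (ENNReal.natCast_lt_top k))).exists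
      obtain ⟨n, hn, h⟩ := hgrow K
      filter_upwards [eventually_ge_atTop n] with m hm
      exact hK.trans_le (h.trans (hmono n hn m hm))
    exact absurd htop.liminf_eq hω.ne
  filter_upwards [ae_all_iff.2 main] with ω hω hu
  refine frequently_atTop.2 fun N => ?_
  have := hω N hu
  push Not at this
  obtain ⟨i, hi, h⟩ := this
  exact ⟨i + 1, hi.trans i.le_succ, h⟩

/-- A strategy of Player 2 that plays every available move with probability bounded below is
fair. -/
theorem fair_of_le {σ₂ : G.Strategy Owner.two} {p : ℝ≥0∞} (hp : p ≠ 0)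
    (h : ∀ l u, ∀ w ∈ G.post u.1, p ≤ σ₂.toFun l u w) : σ₂.Fair := by
  intro σ₁ v
  have key : ∀ u w, G.owner u = Owner.two → w ∈ G.post u → ∀ᵐ ω ∂G.prob σ₁ σ₂ v,
      u ∈ infOften ω → w ∈ infOften ω := fun u w hu hw =>
    G.ae_frequently_of_frequently σ₁ σ₂ v hp fun l => by
      rw [G.step_of_owner_two σ₁ σ₂ l hu]
      exact h l ⟨u, hu⟩ w hw
  have hall : ∀ᵐ ω ∂G.prob σ₁ σ₂ v, ω ∈ G.fairPlays := by
    have key' : ∀ᵐ ω ∂G.prob σ₁ σ₂ v, ∀ u w, G.owner u = Owner.two → w ∈ G.post u →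
        u ∈ infOften ω → w ∈ infOften ω := by
      simp only [ae_all_iff]
      exact key
    filter_upwards [G.ae_mem_paths σ₁ σ₂ v, key'] with ω h1 h2
    exact ⟨h1, fun u hu hi w hw => h2 u w hu hw hi⟩
  have : G.fairPlays =ᵐ[G.prob σ₁ σ₂ v] Set.univ := eventuallyEq_univ.2 hall
  rw [measure_congr this, measure_univ]

end Probability

/-! ### Uniform moves and their mixtures with deterministic choices. -/

/-- The successors of a vertex as a finset. -/
def succs (v : V) : Finset V := open Classical in Finset.univ.filter (· ∈ G.post v)

theorem mem_succs {v w : V} : w ∈ G.succs v ↔ w ∈ G.post v := by simp [succs]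

theorem succs_nonempty (v : V) : (G.succs v).Nonempty := by
  obtain ⟨w, hw⟩ := G.exists_succ v
  exact ⟨w, G.mem_succs.2 hw⟩

/-- The chance distribution at chance vertices, the uniform distribution on the successors at
player vertices. -/
def randomMove (v : V) : PMF V :=
  open Classical in if hv : G.owner v = Owner.chance then G.chancePMF v hv
    else PMF.uniformOfFinset (G.succs v) (G.succs_nonempty v)

theorem randomMove_of_chance {v : V} (hv : G.owner v = Owner.chance) :
    G.randomMove v = G.chancePMF v hv := dif_pos hv

theorem randomMove_of_not_chance {v : V} (hv : G.owner v ≠ Owner.chance) :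
    G.randomMove v = PMF.uniformOfFinset (G.succs v) (G.succs_nonempty v) := dif_neg hv

theorem support_randomMove (v : V) : (G.randomMove v).support = G.post v := by
  by_cases hv : G.owner v = Owner.chance
  · rw [randomMove_of_chance _ hv]
    ext w
    simp [chancePMF, post, pos_iff_ne_zero]
  · rw [randomMove_of_not_chance _ hv]
    ext w
    simp [mem_succs]

theorem randomMove_ne_zero {v w : V} : G.randomMove v w ≠ 0 ↔ w ∈ G.post v := by
  rw [← support_randomMove, PMF.mem_support_iff]

theorem inv_card_le_randomMove {v w : V} (hv : G.owner v = Owner.two) (hw : w ∈ G.post v) :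
    (Fintype.card V : ℝ≥0∞)⁻¹ ≤ G.randomMove v w := by
  rw [randomMove_of_not_chance _ (by simp [hv]),
    PMF.uniformOfFinset_apply_of_mem _ (G.mem_succs.2 hw)]
  gcongr
  exact Finset.card_le_univ _

theorem iInf_le_sum_randomMove (v : V) (g : V → ℝ≥0∞) :
    ⨅ w ∈ G.post v, g w ≤ ∑ w, G.randomMove v w * g w := by
  rw [← one_mul (⨅ w ∈ G.post v, g w), ← sum_pmf (G.randomMove v), Finset.sum_mul]
  refine Finset.sum_le_sum fun w _ => ?_
  by_cases hw : w ∈ G.post v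
  · gcongr
    exact iInf₂_le w hw
  · simp [not_not.1 (mt G.randomMove_ne_zero.1 hw)]

theorem exists_isLeast_post (v : V) (g : V → ℝ≥0∞) :
    ∃ w ∈ G.post v, ∀ w' ∈ G.post v, g w ≤ g w' := by
  obtain ⟨w, hw, h⟩ := (G.succs v).exists_min_image g (G.succs_nonempty v)
  exact ⟨w, G.mem_succs.1 hw, fun w' hw' => h w' (G.mem_succs.2 hw')⟩

theorem exists_isGreatest_post (v : V) (g : V → ℝ≥0∞) :
    ∃ w ∈ G.post v, ∀ w' ∈ G.post v, g w' ≤ g w := by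
  obtain ⟨w, hw, h⟩ := (G.succs v).exists_max_image g (G.succs_nonempty v)
  exact ⟨w, G.mem_succs.1 hw, fun w' hw' => h w' (G.mem_succs.2 hw')⟩

/-- The deterministic memoryless strategy that moves from `v` to `a v`. -/
def pureStrategy (p : Owner) (a : V → V) (ha : ∀ v, a v ∈ G.post v) : G.Strategy p where
  toFun _ v := PMF.pure (a v)
  support_subset h v := by simpa using ha v

/-- The mixture `(1 - ε) * pure a + ε * randomMove v`. -/
def mixedMove (ε : ℝ≥0∞) (hε : ε ≤ 1) (v a : V) : PMF V :=
  PMF.ofFintype (fun w => (1 - ε) * PMF.pure a w + ε * G.randomMove v w) (by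
    rw [Finset.sum_add_distrib, ← Finset.mul_sum, ← Finset.mul_sum, sum_pmf, sum_pmf, mul_one,
      mul_one, tsub_add_cancel_of_le hε])

theorem sum_mixedMove_mul (ε : ℝ≥0∞) (hε : ε ≤ 1) (v a : V) (g : V → ℝ≥0∞) :
    ∑ w, G.mixedMove ε hε v a w * g w =
      (1 - ε) * g a + ε * ∑ w, G.randomMove v w * g w := by
  classical
  simp only [mixedMove, PMF.ofFintype_apply, add_mul, Finset.sum_add_distrib, mul_assoc,
    ← Finset.mul_sum]
  simp [PMF.pure_apply]

/-- The memoryless strategy that mixes the deterministic choice `a` with the uniform one. -/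
def mixedStrategy (ε : ℝ≥0∞) (hε : ε ≤ 1) (a : V → V) (ha : ∀ v, a v ∈ G.post v) :
    G.Strategy Owner.two where
  toFun _ v := G.mixedMove ε hε v (a v)
  support_subset h v w hw := by
    classical
    by_contra hn
    refine hw ?_
    have h1 : w ≠ a v := fun h => hn (h ▸ ha v)
    simp [mixedMove, PMF.pure_apply, h1, not_not.1 (mt G.randomMove_ne_zero.1 hn)]

theorem mixedStrategy_fair [MeasurableSpace V] [MeasurableSingletonClass V] {ε : ℝ≥0∞}
    (h0 : ε ≠ 0) (hε : ε ≤ 1) (a : V → V) (ha : ∀ v, a v ∈ G.post v) :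
    (G.mixedStrategy ε hε a ha).Fair := by
  refine G.fair_of_le (p := ε * (Fintype.card V : ℝ≥0∞)⁻¹) (by simp [h0]) fun l u w hw => ?_
  refine le_trans ?_ (le_add_self :
    ε * G.randomMove u w ≤ (1 - ε) * PMF.pure (a u) w + ε * G.randomMove u w)
  gcongr
  exact G.inv_card_le_randomMove u.2 hw

/-! ### The Bellman operator of the perturbed game. -/

/-- The value at `v` of the Bellman operator for rewards `r` in which Player 2 moves at random with
probability `ε`. -/
def bellmanValue (r : V → ℝ≥0∞) (ε : ℝ≥0∞) (g : V → ℝ≥0∞) (v : V) : ℝ≥0∞ :=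
  r v + match G.owner v with
    | Owner.one => ⨆ w ∈ G.post v, g w
    | Owner.two => (1 - ε) * (⨅ w ∈ G.post v, g w) + ε * ∑ w, G.randomMove v w * g w
    | Owner.chance => ∑ w, G.randomMove v w * g w

/-- The Bellman operator as a monotone map. -/
def bellman (r : V → ℝ≥0∞) (ε : ℝ≥0∞) : (V → ℝ≥0∞) →o (V → ℝ≥0∞) where
  toFun := G.bellmanValue r ε
  monotone' g g' h v := by
    have hsum : ∑ w, G.randomMove v w * g w ≤ ∑ w, G.randomMove v w * g' w := by
      gcongr with w
      exact h w
    unfold bellmanValue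
    gcongr
    split
    · exact iSup₂_mono fun w _ => h w
    · exact add_le_add (mul_le_mul_right (iInf₂_mono fun w _ => h w) _)
        (mul_le_mul_right hsum _)
    · exact hsum

theorem bellman_of_owner_one {r : V → ℝ≥0∞} {ε : ℝ≥0∞} {g : V → ℝ≥0∞} {v : V}
    (hv : G.owner v = Owner.one) :
    G.bellman r ε g v = r v + ⨆ w ∈ G.post v, g w := by
  change G.bellmanValue r ε g v = _
  simp [bellmanValue, hv]

theorem bellman_of_owner_two {r : V → ℝ≥0∞} {ε : ℝ≥0∞} {g : V → ℝ≥0∞} {v : V}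
    (hv : G.owner v = Owner.two) : G.bellman r ε g v =
      r v + ((1 - ε) * (⨅ w ∈ G.post v, g w) + ε * ∑ w, G.randomMove v w * g w) := by
  change G.bellmanValue r ε g v = _
  simp [bellmanValue, hv]

theorem bellman_of_owner_chance {r : V → ℝ≥0∞} {ε : ℝ≥0∞} {g : V → ℝ≥0∞} {v : V}
    (hv : G.owner v = Owner.chance) :
    G.bellman r ε g v = r v + ∑ w, G.randomMove v w * g w := by
  change G.bellmanValue r ε g v = _
  simp [bellmanValue, hv]

/-- Raising `ε` shifts weight from a minimum to an average. -/
theorem bellman_mono_eps {r : V → ℝ≥0∞} {ε ε' : ℝ≥0∞} (h : ε ≤ ε') (h1 : ε' ≤ 1) :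
    G.bellman r ε ≤ G.bellman r ε' := by
  intro g v
  rcases hv : G.owner v
  · simp [bellman_of_owner_one, hv]
  · rw [G.bellman_of_owner_two hv, G.bellman_of_owner_two hv]
    gcongr 1
    obtain ⟨δ, rfl⟩ := exists_add_of_le h
    have : (1 : ℝ≥0∞) - ε = (1 - (ε + δ)) + δ := by
      rw [← tsub_tsub, tsub_add_cancel_of_le]
      exact ENNReal.le_sub_of_add_le_left (ne_top_of_le_ne_top ENNReal.one_ne_top (h.trans h1)) h1
    rw [this, add_mul, add_mul, add_assoc, add_comm (ε * _)]
    gcongr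
    exact G.iInf_le_sum_randomMove v g
  · simp [bellman_of_owner_chance, hv]

/-! ### Drift functions and finiteness of the value. -/

/-- A finite function that is positive at terminal vertices and, on its support, drifts upwards by
at least `R` per nonterminal step when Player 2 moves at random, whatever Player 1 does. -/
structure IsDrift (R : ℝ≥0∞) (d : V → ℝ≥0∞) : Prop where
  ne_top : ∀ v, d v ≠ ∞
  terminal : ∀ v ∈ G.terminal, d v ≠ 0
  one : ∀ v ∉ G.terminal, d v ≠ 0 → G.owner v = Owner.one → ∀ w ∈ G.post v, d v + R ≤ d w
  random : ∀ v ∉ G.terminal, d v ≠ 0 → G.owner v ≠ Owner.one →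
    d v + R ≤ ∑ w, G.randomMove v w * d w

-- Attractor step: `v` joins the support when Player 1 cannot avoid the support, or when a random
-- move enters it with positive probability. Scaling up the old function makes room for a value at
-- `v` with the required drift.
variable {G} in
theorem IsDrift.exists_extend {R : ℝ≥0∞} (hR : R ≠ ∞) {d : V → ℝ≥0∞} (hd : G.IsDrift R d)
    {v : V} (hv : d v = 0) (h1 : G.owner v = Owner.one → ∀ w ∈ G.post v, d w ≠ 0)
    (h2 : G.owner v ≠ Owner.one → ∃ w ∈ G.post v, d w ≠ 0) :
    ∃ d', G.IsDrift R d' ∧ d' v ≠ 0 ∧ ∀ u, d u ≠ 0 → d' u ≠ 0 := by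
  classical
  obtain ⟨m, hm0, hmt, hm1, hm2⟩ : ∃ m : ℝ≥0∞, m ≠ 0 ∧ m ≠ ∞ ∧
      (G.owner v = Owner.one → ∀ w ∈ G.post v, m ≤ d w) ∧
      (G.owner v ≠ Owner.one → m ≤ ∑ w, G.randomMove v w * d w) := by
    by_cases ho : G.owner v = Owner.one
    · obtain ⟨w, hw, hmin⟩ := G.exists_isLeast_post v d
      exact ⟨d w, h1 ho w hw, hd.ne_top w, fun _ => hmin, fun h => absurd ho h⟩
    · refine ⟨∑ w, G.randomMove v w * d w, ?_, ?_, fun h => absurd h ho, fun _ => le_rfl⟩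
      · obtain ⟨w, hw, hw0⟩ := h2 ho
        intro h
        exact mul_ne_zero (G.randomMove_ne_zero.2 hw) hw0
          (Finset.sum_eq_zero_iff.1 h w (Finset.mem_univ w))
      · exact ENNReal.sum_ne_top.2 fun w _ => ENNReal.mul_ne_top (PMF.apply_ne_top _ _)
          (hd.ne_top w)
  -- `C * m ≥ 1 + R` gives the drift out of `v`, where the new value is `1`; `C ≥ 1` preserves the
  -- drift elsewhere.
  let C : ℝ≥0∞ := 1 + (1 + R) / m
  have hC : C ≠ ∞ := ENNReal.add_ne_top.2 ⟨ENNReal.one_ne_top,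
    ENNReal.div_ne_top (ENNReal.add_ne_top.2 ⟨ENNReal.one_ne_top, hR⟩) hm0⟩
  have hC1 : 1 ≤ C := le_self_add
  have hC0 : C ≠ 0 := (zero_lt_one.trans_le hC1).ne'
  have hCm : 1 + R ≤ C * m := by
    calc 1 + R = (1 + R) / m * m := (ENNReal.div_mul_cancel hm0 hmt).symm
      _ ≤ C * m := by gcongr; exact le_add_self
  let d' : V → ℝ≥0∞ := Function.update (fun u => C * d u) v 1
  have hself : d' v = 1 := Function.update_self ..
  have hne : ∀ u, u ≠ v → d' u = C * d u := fun u hu => Function.update_of_ne hu ..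
  have hle : ∀ u, C * d u ≤ d' u := fun u => by
    by_cases hu : u = v
    · simp [hu, hv]
    · rw [hne u hu]
  have hsum : ∀ u, C * ∑ w, G.randomMove u w * d w ≤ ∑ w, G.randomMove u w * d' w := fun u => by
    rw [Finset.mul_sum]
    refine Finset.sum_le_sum fun w _ => ?_
    rw [mul_left_comm]
    gcongr
    exact hle w
  have hpos : ∀ u, d u ≠ 0 → d' u ≠ 0 := fun u hu =>
    ((pos_iff_ne_zero.2 (mul_ne_zero hC0 hu)).trans_le (hle u)).ne'
  have hscale : ∀ u, C * d u + R ≤ C * (d u + R) := fun u => by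
    rw [mul_add]
    gcongr
    exact le_mul_of_one_le_left' hC1
  have hdpos : ∀ u, u ≠ v → d' u ≠ 0 → d u ≠ 0 := fun u hu h h0 => by simp [hne u hu, h0] at h
  refine ⟨d', ⟨fun u => ?_, fun u hu => hpos u (hd.terminal u hu), fun u hu hu0 ho w hw => ?_,
    fun u hu hu0 ho => ?_⟩, by simp [hself], hpos⟩
  · by_cases hu : u = v
    · simp [hu, hself]
    · rw [hne u hu]
      exact ENNReal.mul_ne_top hC (hd.ne_top u)
  · refine le_trans ?_ (hle w)
    by_cases huv : u = v
    · subst huv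
      rw [hself]
      refine hCm.trans ?_
      gcongr
      exact hm1 ho w hw
    · rw [hne u huv]
      refine (hscale u).trans ?_
      gcongr
      exact hd.one u hu (hdpos u huv hu0) ho w hw
  · refine le_trans ?_ (hsum u)
    by_cases huv : u = v
    · subst huv
      rw [hself]
      refine hCm.trans ?_
      gcongr
      exact hm2 ho
    · rw [hne u huv]
      refine (hscale u).trans ?_
      gcongr
      exact hd.random u hu (hdpos u huv hu0) ho

section Probability

variable [MeasurableSpace V] [MeasurableSingletonClass V] (σ₁ : G.Strategy Owner.one)

/-- Take a drift function of maximal support. Where it vanishes, Player 1 can stay in its zero set,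
and random moves cannot leave it. A play starting there against the uniform Player 2 would never
reach a terminal vertex, contradicting stopping. -/
theorem exists_isDrift_pos (hG : G.StoppingUnderFairness) {R : ℝ≥0∞} (hR : R ≠ ∞) :
    ∃ d, G.IsDrift R d ∧ ∀ v, d v ≠ 0 := by
  classical
  have hne : {d | G.IsDrift R d}.Nonempty := by
    refine ⟨fun v => if v ∈ G.terminal then 1 else 0, ⟨fun v => ?_, fun v hv => by simp [hv],
      fun v hv h => ?_, fun v hv h => ?_⟩⟩
    · split_ifs <;> simp
    · simp [hv] at h
    · simp [hv] at h
  obtain ⟨d, hd, hmax⟩ := Set.Finite.exists_maximalFor' (fun d : V → ℝ≥0∞ => {v | d v ≠ 0})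
    {d | G.IsDrift R d} (Set.toFinite _) hne
  refine ⟨d, hd, fun v hv => ?_⟩
  have hext : ∀ u, d u = 0 → ¬ ((G.owner u = Owner.one → ∀ w ∈ G.post u, d w ≠ 0) ∧
      (G.owner u ≠ Owner.one → ∃ w ∈ G.post u, d w ≠ 0)) := by
    rintro u hu ⟨h1, h2⟩
    obtain ⟨d', hd', hu', hle⟩ := IsDrift.exists_extend hR hd hu h1 h2
    exact hmax hd' hle hu' hu
  choose a ha hmin using fun u => G.exists_isLeast_post u d
  -- With zero rewards, the indicator of the zero set is subharmonic and would give `1 ≤ 0`. At `ε =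
  -- 1` Player 2 is purely uniform, so `a` only matters for Player 1.
  have hle := G.le_lintegral_tsum (G.pureStrategy Owner.one a ha) v hG
    (G.mixedStrategy_fair one_ne_zero le_rfl a ha) (r := fun _ => 0)
    (f := fun u => if d u = 0 then 1 else 0) (fun u => by split_ifs <;> simp)
    (fun u hu => by simp [hd.terminal u hu]) ?_
  · simp [hv] at hle
  · intro h u
    by_cases hu : d u = 0
    swap
    · simp [hu]
    simp only [hu, if_true, zero_add]
    refine (G.sum_step (G.pureStrategy Owner.one a ha) (G.mixedStrategy 1 le_rfl a ha) h u).symm.le.trans ?_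
    refine Finset.sum_le_sum fun w _ => ?_
    by_cases hw : G.step (G.pureStrategy Owner.one a ha) (G.mixedStrategy 1 le_rfl a ha) h u w = 0
    · simp [hw]
    suffices d w = 0 by simp [this]
    by_contra hw0
    refine hext u hu ⟨fun ho w' hw' h0 => ?_, fun ho => ⟨w, ?_, hw0⟩⟩
    · rw [step_of_owner_one _ _ _ _ ho] at hw
      have : w = a u := by
        by_contra hne
        exact hw (by simp [pureStrategy, PMF.pure_apply, hne])
      exact hw0 (le_antisymm (this ▸ h0 ▸ hmin u w' hw') zero_le)
    · exact G.step_support_subset _ _ h u hw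

/-- In a game stopping under fairness the expected total reward is uniformly bounded when Player 2
moves at random. -/
theorem exists_bellman_le (hG : G.StoppingUnderFairness) {r : V → ℝ≥0∞} (hr : ∀ v, r v ≠ ∞)
    (hrT : ∀ v ∈ G.terminal, r v = 0) :
    ∃ h : V → ℝ≥0∞, (∀ v, h v ≠ ∞) ∧ (∀ v ∈ G.terminal, h v = 0) ∧ G.bellman r 1 h ≤ h := by
  classical
  obtain ⟨d, hd, hpos⟩ := G.exists_isDrift_pos hG (R := ∑ v, r v)
    (ENNReal.sum_ne_top.2 fun v _ => hr v)
  have hrR : ∀ v, r v ≤ ∑ v, r v := fun v =>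
    Finset.single_le_sum (fun _ _ => zero_le) (Finset.mem_univ v)
  set R := ∑ v, r v
  let D := ∑ v, d v
  have hD : D ≠ ∞ := ENNReal.sum_ne_top.2 fun v _ => hd.ne_top v
  have hdD : ∀ v, d v ≤ D := fun v =>
    Finset.single_le_sum (fun _ _ => zero_le) (Finset.mem_univ v)
  -- Reflecting `d` turns upward drift `R` into downward drift, which pays for every reward since `r
  -- v ≤ R`. Lowering the value to zero at terminal vertices only helps the other inequalities.
  let h : V → ℝ≥0∞ := fun v => if v ∈ G.terminal then 0 else D - d v
  have hT : ∀ v ∈ G.terminal, h v = 0 := fun v hv => by simp [h, hv]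
  have hhd : ∀ v, d v + h v ≤ D := fun v => by
    by_cases hv : v ∈ G.terminal
    · simp [hT v hv, hdD]
    · simp only [h, hv, if_false]
      rw [add_tsub_cancel_of_le (hdD v)]
  have hsum : ∀ v, ∑ w, G.randomMove v w * d w + ∑ w, G.randomMove v w * h w ≤ D := fun v => by
    rw [← Finset.sum_add_distrib, ← one_mul D, ← sum_pmf (G.randomMove v), Finset.sum_mul]
    refine Finset.sum_le_sum fun w _ => ?_
    rw [← mul_add]
    gcongr
    exact hhd w
  refine ⟨h, fun v => ne_top_of_le_ne_top hD (le_add_self.trans (hhd v)), hT, fun v => ?_⟩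
  by_cases hv : v ∈ G.terminal
  · have hpost : ∀ w ∈ G.post v, w = v := fun w hw => by
      by_contra hne
      exact hw.ne' (hv.2 w hne)
    have hav : ∑ w, G.randomMove v w * h w = 0 := Finset.sum_eq_zero fun w _ => by
      by_cases hw : w ∈ G.post v
      · rw [hpost w hw, hT v hv, mul_zero]
      · simp [not_not.1 (mt G.randomMove_ne_zero.1 hw)]
    rw [hT v hv]
    rcases ho : G.owner v
    · rw [G.bellman_of_owner_one ho, hrT v hv, zero_add]
      exact iSup₂_le fun w hw => by rw [hpost w hw, hT v hv]
    · simp [G.bellman_of_owner_two ho, hrT v hv, hav]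
    · simp [G.bellman_of_owner_chance ho, hrT v hv, hav]
  · have hhv : h v = D - d v := by simp [h, hv]
    have hrand : G.owner v ≠ Owner.one → r v + ∑ w, G.randomMove v w * h w ≤ D - d v := by
      intro ho
      refine ENNReal.le_sub_of_add_le_left (hd.ne_top v) ?_
      refine le_trans ?_ (hsum v)
      rw [← add_assoc]
      gcongr
      exact (add_le_add le_rfl (hrR v)).trans (hd.random v hv (hpos v) ho)
    rw [hhv]
    rcases ho : G.owner v
    · rw [G.bellman_of_owner_one ho, ENNReal.add_biSup (show (G.post v).Nonempty from G.exists_succ v)]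
      refine iSup₂_le fun w hw => ENNReal.le_sub_of_add_le_left (hd.ne_top v) ?_
      refine le_trans ?_ (hhd w)
      rw [← add_assoc]
      gcongr
      exact (add_le_add le_rfl (hrR v)).trans (hd.one v hv (hpos v) ho w hw)
    · simpa [G.bellman_of_owner_two ho] using hrand (by simp [ho])
    · simpa [G.bellman_of_owner_chance ho] using hrand (by simp [ho])

end Probability

/-! ### Perturbed values and their limit. -/

variable (r : V → ℝ≥0∞)

/-- The value of the game in which Player 2 moves at random with probability `ε`. -/
def perturbedValue (ε : ℝ≥0∞) : V → ℝ≥0∞ := (G.bellman r ε).lfp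

theorem bellman_perturbedValue (ε : ℝ≥0∞) :
    G.bellman r ε (G.perturbedValue r ε) = G.perturbedValue r ε :=
  (G.bellman r ε).map_lfp

theorem perturbedValue_mono {ε ε' : ℝ≥0∞} (h : ε ≤ ε') (h1 : ε' ≤ 1) :
    G.perturbedValue r ε ≤ G.perturbedValue r ε' :=
  OrderHom.lfp.monotone (G.bellman_mono_eps h h1)

theorem bellman_perturbedValue_apply (ε : ℝ≥0∞) (v : V) :
    G.bellman r ε (G.perturbedValue r ε) v = G.perturbedValue r ε v :=
  congrFun (G.bellman_perturbedValue r ε) v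

/-- The vanishing sequence of perturbations `1 / (k + 1)`. -/
def perturbation (k : ℕ) : ℝ≥0∞ := ((k : ℝ≥0∞) + 1)⁻¹

theorem perturbation_ne_zero (k : ℕ) : perturbation k ≠ 0 := by simp [perturbation]

theorem perturbation_le_one (k : ℕ) : perturbation k ≤ 1 := by simp [perturbation]

theorem antitone_perturbation : Antitone perturbation := fun k l h => by
  unfold perturbation
  gcongr

theorem tendsto_perturbation : Tendsto perturbation atTop (nhds 0) := by
  have := (tendsto_add_atTop_iff_nat 1).2 ENNReal.tendsto_inv_nat_nhds_zero
  simpa only [Nat.cast_add, Nat.cast_one] using! this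

/-- The value of the game against fair adversaries. -/
def fairValue (v : V) : ℝ≥0∞ := ⨅ k, G.perturbedValue r (perturbation k) v

theorem tendsto_fairValue (v : V) :
    Tendsto (fun k => G.perturbedValue r (perturbation k) v) atTop (nhds (G.fairValue r v)) :=
  tendsto_atTop_iInf fun _ _ h =>
    G.perturbedValue_mono r (antitone_perturbation h) (perturbation_le_one _) v

theorem fairValue_le (k : ℕ) (v : V) :
    G.fairValue r v ≤ G.perturbedValue r (perturbation k) v := iInf_le _ k

/-- If every successor fell strictly short, then, there being finitely many, all would do so at one
common `k`, against the Bellman equation there. -/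
theorem fairValue_of_owner_one {v : V} (hv : G.owner v = Owner.one) :
    ∃ w ∈ G.post v, G.fairValue r v ≤ r v + G.fairValue r w := by
  by_contra! h
  have hev : ∀ᶠ k in atTop, ∀ w ∈ G.post v,
      r v + G.perturbedValue r (perturbation k) w < G.fairValue r v :=
    (Set.toFinite (G.post v)).eventually_all.2 fun w hw =>
      ((G.tendsto_fairValue r w).const_add (r v)).eventually (gt_mem_nhds (h w hw))
  obtain ⟨k, hk⟩ := hev.exists
  obtain ⟨w, hw, hmax⟩ := G.exists_isGreatest_post v (G.perturbedValue r (perturbation k))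
  refine ((hk w hw).trans_le (G.fairValue_le r k v)).not_ge ?_
  rw [← bellman_perturbedValue_apply, G.bellman_of_owner_one hv]
  gcongr
  exact iSup₂_le hmax

/-- The random part costs at most `ε * K`, where `K` is an average of the values at `ε = 1`;
finiteness of `K` makes this vanish in the limit. -/
theorem fairValue_of_owner_two {v : V} (hv : G.owner v = Owner.two)
    (hfin : ∀ w, G.perturbedValue r 1 w ≠ ∞) {w : V} (hw : w ∈ G.post v) :
    G.fairValue r v ≤ r v + G.fairValue r w := by
  let K := ∑ w, G.randomMove v w * G.perturbedValue r 1 w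
  have hK : K ≠ ∞ := ENNReal.sum_ne_top.2 fun w _ =>
    ENNReal.mul_ne_top (PMF.apply_ne_top _ _) (hfin w)
  have hle : ∀ k, G.fairValue r v ≤
      r v + (G.perturbedValue r (perturbation k) w + perturbation k * K) := fun k => by
    refine (G.fairValue_le r k v).trans ?_
    rw [← bellman_perturbedValue_apply, G.bellman_of_owner_two hv]
    gcongr
    · exact (mul_le_of_le_one_left' tsub_le_self).trans (iInf₂_le w hw)
    · simp only [K]
      gcongr with u
      exact G.perturbedValue_mono r (perturbation_le_one k) le_rfl u
  have hlim := ((G.tendsto_fairValue r w).add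
    (ENNReal.Tendsto.mul_const tendsto_perturbation (Or.inr hK))).const_add (r v)
  rw [zero_mul, add_zero] at hlim
  exact ge_of_tendsto' hlim hle

theorem fairValue_of_owner_chance {v : V} (hv : G.owner v = Owner.chance) :
    G.fairValue r v ≤ r v + ∑ w, G.chancePMF v hv w * G.fairValue r w := by
  have hlim : Tendsto (fun k => r v +
      ∑ w, G.chancePMF v hv w * G.perturbedValue r (perturbation k) w) atTop
      (nhds (r v + ∑ w, G.chancePMF v hv w * G.fairValue r w)) :=
    (tendsto_finsetSum _ fun w _ => ENNReal.Tendsto.const_mul (G.tendsto_fairValue r w)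
      (Or.inr (PMF.apply_ne_top _ _))).const_add (r v)
  refine ge_of_tendsto' hlim fun k => (G.fairValue_le r k v).trans ?_
  rw [← G.bellman_perturbedValue_apply, G.bellman_of_owner_chance hv, G.randomMove_of_chance hv]

theorem sum_pmf_mul_le {s : PMF V} {g : V → ℝ≥0∞} {c : ℝ≥0∞} (h : ∀ w ∈ s.support, g w ≤ c) :
    ∑ w, s w * g w ≤ c := by
  rw [← one_mul c, ← sum_pmf s, Finset.sum_mul]
  refine Finset.sum_le_sum fun w _ => ?_
  by_cases hw : s w = 0
  · simp [hw]
  · gcongr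
    exact h w hw

theorem le_sum_pmf_mul {s : PMF V} {g : V → ℝ≥0∞} {c : ℝ≥0∞} (h : ∀ w ∈ s.support, c ≤ g w) :
    c ≤ ∑ w, s w * g w := by
  rw [← one_mul c, ← sum_pmf s, Finset.sum_mul]
  refine Finset.sum_le_sum fun w _ => ?_
  by_cases hw : s w = 0
  · simp [hw]
  · gcongr
    exact h w hw

/-! ### Memoryless strategies guaranteeing these values. -/

section Probability

variable [MeasurableSpace V] [MeasurableSingletonClass V]

/-- Player 2 has a memoryless fair strategy that guarantees the perturbed value against every
strategy of Player 1. -/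
theorem exists_memoryless_fair_le {ε : ℝ≥0∞} (h0 : ε ≠ 0) (hε : ε ≤ 1) :
    ∃ σ₂ : G.Strategy Owner.two, σ₂.Memoryless ∧ σ₂.Fair ∧
      ∀ (σ₁ : G.Strategy Owner.one) (v : V),
        ∫⁻ ω, ∑' i, r (ω i) ∂G.prob σ₁ σ₂ v ≤ G.perturbedValue r ε v := by
  choose a ha hmin using fun u => G.exists_isLeast_post u (G.perturbedValue r ε)
  refine ⟨G.mixedStrategy ε hε a ha, fun _ _ => rfl, G.mixedStrategy_fair h0 hε a ha,
    fun σ₁ v => G.lintegral_tsum_le σ₁ _ v fun h u => ?_⟩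
  conv_rhs => rw [← bellman_perturbedValue_apply]
  rcases ho : G.owner u
  · rw [G.bellman_of_owner_one ho, step_of_owner_one _ _ _ _ ho]
    gcongr
    exact sum_pmf_mul_le fun w hw => le_iSup₂ (f := fun w (_ : w ∈ G.post u) =>
      G.perturbedValue r ε w) w (σ₁.support_subset _ _ hw)
  · rw [G.bellman_of_owner_two ho, step_of_owner_two _ _ _ _ ho]
    gcongr
    refine (G.sum_mixedMove_mul ε hε u (a u) _).le.trans ?_
    gcongr
    exact le_iInf₂ (hmin u)
  · rw [G.bellman_of_owner_chance ho, step_of_owner_chance _ _ _ _ ho, G.randomMove_of_chance ho]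

variable {r} in
/-- Player 1 has a memoryless strategy that guarantees the fair value against every fair strategy
of Player 2. -/
theorem exists_memoryless_fairValue_le (hG : G.StoppingUnderFairness) (hr : ∀ v, r v ≠ ∞)
    (hrT : ∀ v ∈ G.terminal, r v = 0) :
    ∃ σ₁ : G.Strategy Owner.one, σ₁.Memoryless ∧
      ∀ σ₂ : G.Strategy Owner.two, σ₂.Fair → ∀ v : V,
        G.fairValue r v ≤ ∫⁻ ω, ∑' i, r (ω i) ∂G.prob σ₁ σ₂ v := by
  obtain ⟨h, hfin, hT, hle⟩ := G.exists_bellman_le hG hr hrT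
  have hp : G.perturbedValue r 1 ≤ h := OrderHom.lfp_le _ hle
  have hpfin : ∀ w, G.perturbedValue r 1 w ≠ ∞ := fun w => ne_top_of_le_ne_top (hfin w) (hp w)
  have hf : ∀ u, G.fairValue r u ≤ h u := fun u => (G.fairValue_le r 0 u).trans
    ((G.perturbedValue_mono r (perturbation_le_one 0) le_rfl u).trans (hp u))
  -- Player 1 greedily maximises the limit value, so one strategy serves against all fair opponents.
  choose a ha hmax using fun u => G.exists_isGreatest_post u (G.fairValue r)
  refine ⟨G.pureStrategy Owner.one a ha, fun _ _ => rfl, fun σ₂ hσ₂ v =>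
    G.le_lintegral_tsum _ v hG hσ₂ (fun u => ne_top_of_le_ne_top (hfin u) (hf u))
      (fun u hu => le_antisymm ((hf u).trans (hT u hu).le) zero_le) fun l u => ?_⟩
  rcases ho : G.owner u
  · rw [step_of_owner_one _ _ _ _ ho]
    obtain ⟨w, hw, hle⟩ := G.fairValue_of_owner_one r ho
    refine hle.trans ?_
    gcongr
    refine (hmax u w hw).trans (le_sum_pmf_mul fun w' hw' => ?_)
    have : w' = a u := by simpa [pureStrategy] using hw'
    rw [this]
  · rw [step_of_owner_two _ _ _ _ ho]
    obtain ⟨w, hw, hmin⟩ := G.exists_isLeast_post u (G.fairValue r)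
    refine (G.fairValue_of_owner_two r ho hpfin hw).trans ?_
    gcongr
    exact le_sum_pmf_mul fun w' hw' => hmin w' (σ₂.support_subset _ _ hw')
  · rw [step_of_owner_chance _ _ _ _ ho]
    exact G.fairValue_of_owner_chance r ho

end Probability

end StochasticGame

/-! ### The two suprema coincide. -/

theorem mainTheorem9 {V : Type*} [Fintype V] [MeasurableSpace V] [MeasurableSingletonClass V]
    (G : RewardGame V) (hG : G.StoppingUnderFairness) (v : V) :
    (⨆ σ₁ ∈ {σ₁ : G.Strategy Owner.one | σ₁.SemiMarkov},
      ⨅ σ₂ ∈ {σ₂ : G.Strategy Owner.two | σ₂.Memoryless ∧ σ₂.Fair},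
        G.expectedReward σ₁ σ₂ v)
    = ⨆ σ₁ ∈ {σ₁ : G.Strategy Owner.one | σ₁.Memoryless},
      ⨅ σ₂ ∈ {σ₂ : G.Strategy Owner.two | σ₂.Memoryless ∧ σ₂.Fair},
        G.expectedReward σ₁ σ₂ v := by
  let r : V → ℝ≥0∞ := fun u => G.r u
  apply le_antisymm
  · obtain ⟨τ, hτ, hτle⟩ := G.exists_memoryless_fairValue_le hG (r := r)
      (fun _ => ENNReal.coe_ne_top) (fun u hu => by simp [r, G.r_terminal u hu])
    refine iSup₂_le fun σ₁ _ => le_trans ?_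
      ((le_iInf₂ fun σ₂ hσ₂ => hτle σ₂ hσ₂.2 v).trans
        (le_iSup₂ (f := fun (σ₁ : G.Strategy Owner.one) (_ : σ₁ ∈ {σ₁ :
            G.Strategy Owner.one | σ₁.Memoryless}) =>
          ⨅ σ₂ ∈ {σ₂ : G.Strategy Owner.two | σ₂.Memoryless ∧ σ₂.Fair},
            G.expectedReward σ₁ σ₂ v) τ hτ))
    -- For each `k`, the perturbed strategy of Player 2 caps what `σ₁` can guarantee.
    refine le_iInf fun k => ?_
    obtain ⟨σ₂, hm, hf, hle⟩ := G.exists_memoryless_fair_le r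
      (StochasticGame.perturbation_ne_zero k) (StochasticGame.perturbation_le_one k)
    exact (iInf₂_le σ₂ ⟨hm, hf⟩).trans (hle σ₁ v)
  · refine biSup_mono fun σ₁ hσ₁ u h h' _ w => ?_
    rw [hσ₁ (u :: h) w, hσ₁ (u :: h') w]

end
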